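/- Let $(M,g)$ be an oriented smooth Riemannian manifold of dimension $n\ge 1$, possibly with boundary, with volume form $\mathcal V$, Hodge star $\star$ and Levi-Civita connection $\nabla$. Let $u$ be a $C^1$ vector field on $M$ (the velocity at a fixed time), $T:M\to(0,\infty)$ a $C^1$ function (the temperature), and $k,\lambda,\kappa:M\to\mathbb R$ functions (heat conductivity, bulk viscosity and shear viscosity; constants in particular). For a vector-valued $1$-form $\alpha$ and a covector-valued $(n-1)$-form $\beta$, let $\alpha\,\dot\wedge\,\beta$ be the $n$-form obtained by the duality pairing of the values and the wedge product of the form parts; let $\star_2$ be the Hodge star applied to the form leg (the second leg) of a covector-valued $1$-form; regard an $n$-form $\omega$ as the covector-valued $(n-1)$-form $(v_2,\dots,v_n)\mapsto\omega(\,\cdot\,,v_2,\dots,v_n)$; and regard $\nabla u$ as the vector-valued $1$-form $X\mapsto\nabla_Xu$. For a heat flux $Q$ (an $(n-1)$-form) and a residual stress $\mathcal T_r$ (a covector-valued $(n-1)$-form) the entropy sources due to temperature gradients and to the residual stress are $$\mathfrak d_T:=-\frac1{T^2}\,dT\wedge Q,\qquad \mathfrak d_{\mathcal T_r}:=\frac1T\,\nabla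 u\,\dot\wedge\,\mathcal T_r .$$ Take Fourier's law $Q=-k\star dT$ and the Newtonian viscous stress $\mathcal T_r=\lambda\,\mathrm{div}(u)\,\mathcal V+2\kappa\,\star_2\varepsilon$, where $\varepsilon=\tfrac12 L_ug$ is the rate of strain and $\mathrm{div}(u)=\nabla_bu^b$. Then $$\mathfrak d_T=\frac{k}{T^2}\,dT\wedge\star dT,\qquad \mathfrak d_{\mathcal T_r}=\frac1T\bigl(\lambda\,\mathrm{div}(u)^2+2\kappa\,\varepsilon:\varepsilon\bigr)\mathcal V,$$ where $\varepsilon:\varepsilon=g^{ia}g^{jb}\varepsilon_{ij}\varepsilon_{ab}$. Moreover $\mathfrak d_T\ge 0$ if $k\ge 0$, and $\mathfrak d_{\mathcal T_r}\ge 0$ if $\lambda\ge 0$ and $\kappa\ge 0$, where an $n$-form is called nonnegative if it is nonnegative on every positively oriented basis of every tangent space. -/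

import Mathlib

open Bundle Module FiberBundle VectorField
open scoped Manifold ContDiff Topology TensorProduct

noncomputable section

namespace FourierNavierStokes

/-! ### Exterior algebra on an oriented inner product space -/

section Pointwise

variable {V : Type*} [AddCommGroup V] [Module ℝ V]
variable {N N₁ N₂ N₃ : Type*} [AddCommGroup N] [Module ℝ N] [AddCommGroup N₁] [Module ℝ N₁]
  [AddCommGroup N₂] [Module ℝ N₂] [AddCommGroup N₃] [Module ℝ N₃]

/-- The exterior product of an `N₁`-valued `p`-form and an `N₂`-valued `q`-form, where the values
are multiplied by a bilinear map `B`: the sum over `(p, q)`-shuffles, with signs. -/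
def wedgeWith {p q n : ℕ} (h : p + q = n) (B : N₁ →ₗ[ℝ] N₂ →ₗ[ℝ] N₃)
    (α : V [⋀^Fin p]→ₗ[ℝ] N₁) (β : V [⋀^Fin q]→ₗ[ℝ] N₂) : V [⋀^Fin n]→ₗ[ℝ] N₃ :=
  ((TensorProduct.lift B).compAlternatingMap (α.domCoprod β)).domDomCongr
    (finSumFinEquiv.trans (finCongr h))

/-- The wedge product of scalar-valued forms. -/
def wedge {p q n : ℕ} (h : p + q = n)
    (α : V [⋀^Fin p]→ₗ[ℝ] ℝ) (β : V [⋀^Fin q]→ₗ[ℝ] ℝ) : V [⋀^Fin n]→ₗ[ℝ] ℝ :=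
  wedgeWith h (LinearMap.mul ℝ ℝ) α β

/-- The product of a vector-valued `p`-form and a covector-valued `q`-form: duality
pairing of the values and wedge product of the forms. -/
def dotWedge {p q n : ℕ} (h : p + q = n)
    (α : V [⋀^Fin p]→ₗ[ℝ] V) (β : V [⋀^Fin q]→ₗ[ℝ] Dual ℝ V) : V [⋀^Fin n]→ₗ[ℝ] ℝ :=
  wedgeWith h (Dual.eval ℝ V) α β

/-- A linear map `V → N` as an `N`-valued `1`-form. -/
def oneForm (f : V →ₗ[ℝ] N) : V [⋀^Fin 1]→ₗ[ℝ] N :=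
  AlternatingMap.ofSubsingleton ℝ V N (0 : Fin 1) f

/-- Insertion of the vectors `w` into the first `p` slots of an `n`-form. -/
def insertFirst {p q n : ℕ} (h : p + q = n) (η : V [⋀^Fin n]→ₗ[ℝ] ℝ) (w : Fin p → V) :
    V [⋀^Fin q]→ₗ[ℝ] ℝ where
  toFun v := η.domDomCongr (finSumFinEquiv.trans (finCongr h)).symm (Sum.elim w v)
  map_update_add' v i a b := by
    classical
    simp only [← Sum.update_elim_inr, AlternatingMap.map_update_add]
  map_update_smul' v i c a := by
    classical
    simp only [← Sum.update_elim_inr, AlternatingMap.map_update_smul]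
  map_eq_zero_of_eq' v i j hv hij :=
    AlternatingMap.map_eq_zero_of_eq _ _ (i := Sum.inr i) (j := Sum.inr j) (by simpa using hv)
      (by simpa using hij)

/-- A scalar form times a fixed value. -/
def formSMul {q : ℕ} (η : V [⋀^Fin q]→ₗ[ℝ] ℝ) (c : N) : V [⋀^Fin q]→ₗ[ℝ] N :=
  (LinearMap.toSpanSingleton ℝ N c).compAlternatingMap η

/-- An `(m+1)`-form regarded as a covector-valued `m`-form: the covector is the first slot. -/
def topAsCovectorValued {m : ℕ} (η : V [⋀^Fin (m + 1)]→ₗ[ℝ] ℝ) :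
    V [⋀^Fin m]→ₗ[ℝ] Dual ℝ V where
  toFun v :=
    { toFun := fun w => η.curryLeft w v
      map_add' := fun a b => by rw [map_add]; rfl
      map_smul' := fun c a => by rw [map_smul]; rfl }
  map_update_add' v i a b := by ext w; exact (η.curryLeft w).map_update_add' v i a b
  map_update_smul' v i c a := by ext w; exact (η.curryLeft w).map_update_smul' v i c a
  map_eq_zero_of_eq' v i j hv hij := by
    ext w; exact (η.curryLeft w).map_eq_zero_of_eq' v i j hv hij

/-- A top-form is nonnegative with respect to an orientation if it is nonnegative on every
positively oriented basis. -/
def TopFormNonneg {n : ℕ} (o : Orientation ℝ V (Fin n)) (η : V [⋀^Fin n]→ₗ[ℝ] ℝ) : Prop :=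
  ∀ b : Basis (Fin n) ℝ V, b.orientation = o → 0 ≤ η b

end Pointwise

section Metric

variable {V : Type*} [NormedAddCommGroup V] [InnerProductSpace ℝ V]
  {N : Type*} [AddCommGroup N] [Module ℝ N]

/-- The Hodge star, acting on the form leg of an `N`-valued `p`-form:
`(⋆β)(v) = (1 / p!) ∑ β(e_{i₁}, …, e_{iₚ}) 𝒱(e_{i₁}, …, e_{iₚ}, v)` for an orthonormal basis `e`.
For `N = ℝ` it is the form with `α ∧ ⋆β = ⟨α, β⟩ 𝒱` for all `p`-forms `α`. -/
def hodgeStar {p q n : ℕ} (h : p + q = n) [FiniteDimensional ℝ V] [Fact (finrank ℝ V = n)]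
    (o : Orientation ℝ V (Fin n)) (β : V [⋀^Fin p]→ₗ[ℝ] N) : V [⋀^Fin q]→ₗ[ℝ] N :=
  (p.factorial : ℝ)⁻¹ • ∑ f : Fin p → Fin (finrank ℝ V),
    formSMul (insertFirst h o.volumeForm fun i => stdOrthonormalBasis ℝ V (f i))
      (β fun i => stdOrthonormalBasis ℝ V (f i))

/-- The double contraction `ζ : σ = g^{ia} g^{jb} ζ_{ij} σ_{ab}`, in an orthonormal basis. -/
def doubleContraction [FiniteDimensional ℝ V] (ζ σ : V →ₗ[ℝ] V →ₗ[ℝ] ℝ) : ℝ :=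
  ∑ i, ∑ j, ζ (stdOrthonormalBasis ℝ V i) (stdOrthonormalBasis ℝ V j) *
    σ (stdOrthonormalBasis ℝ V i) (stdOrthonormalBasis ℝ V j)

end Metric

/-! ### Riemannian geometry -/

section Manifold

variable {E : Type*} [NormedAddCommGroup E] [NormedSpace ℝ E]
  {H : Type*} [TopologicalSpace H] {I : ModelWithCorners ℝ E H}
  {M : Type*} [TopologicalSpace M] [ChartedSpace H M]

instance [FiniteDimensional ℝ E] (x : M) : FiniteDimensional ℝ (TangentSpace I x) :=
  inferInstanceAs (FiniteDimensional ℝ E)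

instance {n : ℕ} [h : Fact (finrank ℝ E = n)] (x : M) : Fact (finrank ℝ (TangentSpace I x) = n) :=
  h

variable [RiemannianBundle (fun x : M ↦ TangentSpace I x)]

/-- The function `X (g(Y, Z))`. -/
def dirDerivInner (X Y Z : Π x : M, TangentSpace I x) (x : M) : ℝ :=
  mvfderiv I (fun y : M ↦ inner ℝ (Y y) (Z y)) x (X x)

theorem dirDerivInner_comm (X Y Z : Π x : M, TangentSpace I x) (x : M) :
    dirDerivInner X Y Z x = dirDerivInner X Z Y x := by
  unfold dirDerivInner
  simp only [real_inner_comm]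

/-- Half the right-hand side of the Koszul formula for `g(∇_X u, Z)`. -/
def koszul (u X Z : Π x : M, TangentSpace I x) (x : M) : ℝ :=
  (1 / 2) * (dirDerivInner X u Z x + dirDerivInner u Z X x - dirDerivInner Z X u x
    + inner ℝ (mlieBracket I X u x) (Z x) - inner ℝ (mlieBracket I u Z x) (X x)
    + inner ℝ (mlieBracket I Z X x) (u x))

/-- `(L_u g)(X, Y) = u (g(X, Y)) - g([u, X], Y) - g(X, [u, Y])`, on vector fields. -/
def lieDerivMetricAux (u X Y : Π x : M, TangentSpace I x) (x : M) : ℝ :=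
  dirDerivInner u X Y x - inner ℝ (mlieBracket I u X x) (Y x)
    - inner ℝ (X x) (mlieBracket I u Y x)

theorem lieDerivMetricAux_comm (u X Y : Π x : M, TangentSpace I x) (x : M) :
    lieDerivMetricAux u X Y x = lieDerivMetricAux u Y X x := by
  unfold lieDerivMetricAux
  rw [dirDerivInner_comm, real_inner_comm (Y x), real_inner_comm _ (X x)]
  ring

variable [IsManifold I 2 M] {u X Y Z W : Π x : M, TangentSpace I x} {x : M} {f : M → ℝ}

theorem ext_inner_extend {v w : TangentSpace I x}
    (h : ∀ Z : Π x : M, TangentSpace I x, MDiffAt (T% Z) x → inner ℝ v (Z x) = inner ℝ w (Z x)) :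
    v = w := by
  refine ext_inner_right ℝ fun z ↦ ?_
  simpa using h (extend E z) (mdifferentiableAt_extend ..)

variable [IsContMDiffRiemannianBundle I 1 E (fun x : M ↦ TangentSpace I x)]

theorem mdifferentiableAt_inner (hY : MDiffAt (T% Y) x) (hZ : MDiffAt (T% Z) x) :
    MDiffAt (fun y : M ↦ (inner ℝ (Y y) (Z y) : ℝ)) x :=
  MDifferentiableAt.inner_bundle (F := E) (E := fun x : M ↦ TangentSpace I x) hY hZ

theorem dirDerivInner_smul_left (X : Π x : M, TangentSpace I x) (hf : MDiffAt f x)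
    (hY : MDiffAt (T% Y) x) (hZ : MDiffAt (T% Z) x) :
    dirDerivInner X (f • Y) Z x
      = f x * dirDerivInner X Y Z x + mvfderiv I f x (X x) * inner ℝ (Y x) (Z x) := by
  simp [dirDerivInner, inner_smul_left, mvfderiv_fun_mul hf (mdifferentiableAt_inner hY hZ)]
  ring

theorem dirDerivInner_add_left (X : Π x : M, TangentSpace I x)
    (hY : MDiffAt (T% Y) x) (hW : MDiffAt (T% W) x) (hZ : MDiffAt (T% Z) x) :
    dirDerivInner X (Y + W) Z x = dirDerivInner X Y Z x + dirDerivInner X W Z x := by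
  simp [dirDerivInner, inner_add_left, mvfderiv_fun_add (mdifferentiableAt_inner hY hZ) (mdifferentiableAt_inner hW hZ)]

variable [FiniteDimensional ℝ E]

theorem koszul_add (hu : MDiffAt (T% u) x) (hW : MDiffAt (T% W) x) (hX : MDiffAt (T% X) x)
    (hZ : MDiffAt (T% Z) x) : koszul (u + W) X Z x = koszul u X Z x + koszul W X Z x := by
  simp only [koszul, dirDerivInner_comm Z X, dirDerivInner_add_left _ hu hW hZ,
    dirDerivInner_add_left _ hu hW hX, mlieBracket_add_left hu hW, mlieBracket_add_right hu hW]
  simp [dirDerivInner, inner_add_left, inner_add_right]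
  ring

theorem koszul_smul (hu : MDiffAt (T% u) x) (hf : MDiffAt f x) (hX : MDiffAt (T% X) x)
    (hZ : MDiffAt (T% Z) x) :
    koszul (f • u) X Z x
      = f x * koszul u X Z x + mvfderiv I f x (X x) * inner ℝ (u x) (Z x) := by
  simp only [koszul, dirDerivInner_comm Z X, dirDerivInner_smul_left _ hf hu hZ,
    dirDerivInner_smul_left _ hf hu hX, mlieBracket_smul_left hf hu, mlieBracket_smul_right hf hu]
  simp [dirDerivInner, inner_add_left, inner_smul_left, inner_smul_right]
  ring

theorem koszul_tensorial₁ (hu : MDiffAt (T% u) x) (hZ : MDiffAt (T% Z) x) :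
    TensorialAt I E (fun X ↦ koszul u X Z x) x where
  smul {f X} hf hX := by
    simp only [koszul, dirDerivInner_comm u Z (f • X), dirDerivInner_comm u Z X,
      dirDerivInner_smul_left _ hf hX hZ, dirDerivInner_smul_left _ hf hX hu,
      mlieBracket_smul_left hf hX, mlieBracket_smul_right hf hX]
    simp [dirDerivInner, inner_add_left, inner_smul_left, inner_smul_right]
    rw [real_inner_comm (u x) (X x)]
    ring
  add {X X'} hX hX' := by
    simp only [koszul, dirDerivInner_comm u Z (X + X'), dirDerivInner_comm u Z X,
      dirDerivInner_comm u Z X', dirDerivInner_add_left _ hX hX' hZ,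
      dirDerivInner_add_left _ hX hX' hu, mlieBracket_add_left hX hX', mlieBracket_add_right hX hX']
    simp [dirDerivInner, inner_add_left, inner_add_right]
    ring

theorem koszul_tensorial₂ (hu : MDiffAt (T% u) x) (hX : MDiffAt (T% X) x) :
    TensorialAt I E (fun Z ↦ koszul u X Z x) x where
  smul {f Z} hf hZ := by
    simp only [koszul, dirDerivInner_comm X u (f • Z), dirDerivInner_comm X u Z,
      dirDerivInner_smul_left _ hf hZ hX, dirDerivInner_smul_left _ hf hZ hu,
      mlieBracket_smul_left hf hZ, mlieBracket_smul_right hf hZ]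
    simp [dirDerivInner, inner_add_left, inner_smul_left, inner_smul_right]
    ring
  add {Z Z'} hZ hZ' := by
    simp only [koszul, dirDerivInner_comm X u (Z + Z'), dirDerivInner_comm X u Z,
      dirDerivInner_comm X u Z', dirDerivInner_add_left _ hZ hZ' hX,
      dirDerivInner_add_left _ hZ hZ' hu, mlieBracket_add_left hZ hZ', mlieBracket_add_right hZ hZ']
    simp [dirDerivInner, inner_add_left, inner_add_right]
    ring

theorem lieDerivMetricAux_tensorial (u : Π x : M, TangentSpace I x) (hY : MDiffAt (T% Y) x) :
    TensorialAt I E (fun X ↦ lieDerivMetricAux u X Y x) x where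
  smul {f X} hf hX := by
    simp only [lieDerivMetricAux, dirDerivInner_smul_left _ hf hX hY,
      mlieBracket_smul_right hf hX]
    simp [inner_add_left, inner_smul_left]
    ring
  add {X X'} hX hX' := by
    simp only [lieDerivMetricAux, dirDerivInner_add_left _ hX hX' hY,
      mlieBracket_add_right hX hX']
    simp [inner_add_left]
    ring

/-- The Lie derivative `L_u g` of the metric along a vector field `u`. -/
def lieDerivMetric (u : Π x : M, TangentSpace I x) (x : M) :
    TangentSpace I x →L[ℝ] TangentSpace I x →L[ℝ] ℝ :=
  TensorialAt.mkHom₂ (I := I) (F := E) (F' := E) (fun X Y ↦ lieDerivMetricAux u X Y x) x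
    (fun _ hY ↦ lieDerivMetricAux_tensorial u hY)
    (fun _ hX ↦ by
      simpa only [lieDerivMetricAux_comm u] using! lieDerivMetricAux_tensorial u hX)

/-- The bilinear form `(X, Z) ↦ g(∇_X u, Z)` given by the Koszul formula. -/
def koszulForm (u : Π x : M, TangentSpace I x) (x : M) (hu : MDiffAt (T% u) x) :
    TangentSpace I x →L[ℝ] TangentSpace I x →L[ℝ] ℝ :=
  TensorialAt.mkHom₂ (I := I) (F := E) (F' := E) (fun X Z ↦ koszul u X Z x) x
    (fun _ hZ ↦ koszul_tensorial₁ hu hZ) (fun _ hX ↦ koszul_tensorial₂ hu hX)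

open Classical in
/-- The covariant differential `∇u` of a vector field for the Levi-Civita connection, `X ↦ ∇_X u`
(the zero map where `u` is not differentiable). -/
def leviCivitaFun (u : Π x : M, TangentSpace I x) (x : M) :
    TangentSpace I x →L[ℝ] TangentSpace I x :=
  haveI : CompleteSpace (TangentSpace I x) := FiniteDimensional.complete ℝ _
  if hu : MDiffAt (T% u) x then
    LinearMap.toContinuousLinearMap
      { toFun := fun v ↦ (InnerProductSpace.toDual ℝ (TangentSpace I x)).symm (koszulForm u x hu v)
        map_add' := fun v w ↦ by simp
        map_smul' := fun c v ↦ by simp }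
  else 0

theorem inner_leviCivitaFun (hu : MDiffAt (T% u) x) (hX : MDiffAt (T% X) x)
    (hZ : MDiffAt (T% Z) x) : inner ℝ (leviCivitaFun u x (X x)) (Z x) = koszul u X Z x := by
  have : CompleteSpace (TangentSpace I x) := FiniteDimensional.complete ℝ _
  rw [leviCivitaFun, dif_pos hu]
  refine Eq.trans (InnerProductSpace.toDual_symm_apply (𝕜 := ℝ)) ?_
  exact TensorialAt.mkHom₂_apply _ _ hX hZ

/-- The Levi-Civita connection. -/
def leviCivita : CovariantDerivative I E (fun x : M ↦ TangentSpace I x) where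
  toFun := leviCivitaFun
  isCovariantDerivativeOnUniv :=
    { add := fun {u u' x} hu hu' _ ↦ by
        ext v
        refine ext_inner_extend fun Z hZ ↦ ?_
        have hX := mdifferentiableAt_extend I E v
        have h := inner_leviCivitaFun (mdifferentiableAt_add_section hu hu') hX hZ
        rw [koszul_add hu hu' hX hZ, ← inner_leviCivitaFun hu hX hZ,
          ← inner_leviCivitaFun hu' hX hZ, ← inner_add_left] at h
        simpa using! h
      leibniz := fun {u f x} hu hf _ ↦ by
        ext v
        refine ext_inner_extend fun Z hZ ↦ ?_
        have hX := mdifferentiableAt_extend I E v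
        have h := inner_leviCivitaFun (hf.smul_section hu) hX hZ
        have h' := koszul_smul hu hf hX hZ
        rw [← inner_leviCivitaFun hu hX hZ] at h'
        refine Eq.trans (by simpa using! h.trans h') ?_
        simp [inner_add_left, inner_smul_left] }

theorem inner_leviCivita (hu : MDiffAt (T% u) x) (hX : MDiffAt (T% X) x)
    (hZ : MDiffAt (T% Z) x) : inner ℝ (leviCivita u x (X x)) (Z x) = koszul u X Z x :=
  inner_leviCivitaFun hu hX hZ

theorem leviCivita_torsion : (leviCivita (I := I) (M := M)).torsion = 0 := by
  rw [CovariantDerivative.torsion_eq_zero_iff]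
  intro X Y x hX hY
  refine ext_inner_extend fun Z hZ ↦ ?_
  rw [inner_sub_left, inner_leviCivita hY hX hZ, inner_leviCivita hX hY hZ]
  simp only [koszul, mlieBracket_swap_apply (V := Y) (W := X),
    mlieBracket_swap_apply (V := Y) (W := Z), mlieBracket_swap_apply (V := Z) (W := X),
    dirDerivInner_comm Y X Z, dirDerivInner_comm X Y Z, dirDerivInner_comm Z X Y, inner_neg_left]
  ring

theorem leviCivita_isMetricCompatible :
    CovariantDerivative.IsMetricCompatible (I := I) (F := E) (V := fun x : M ↦ TangentSpace I x)
      leviCivita := by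
  rw [CovariantDerivative.isMetricCompatible_iff]
  intro x X Y Z hX hY hZ
  have h1 := inner_leviCivita hY hX hZ
  have h2 := inner_leviCivita hZ hX hY
  rw [real_inner_comm] at h2
  refine Eq.trans ?_ (congrArg₂ (· + ·) h1 h2).symm
  simp only [koszul, mlieBracket_swap_apply (V := Z) (W := Y),
    mlieBracket_swap_apply (V := X) (W := Z), mlieBracket_swap_apply (V := Y) (W := X),
    dirDerivInner_comm X Z Y, dirDerivInner_comm Y Z X, dirDerivInner_comm Z X Y, inner_neg_left]
  unfold dirDerivInner
  ring

/-! ### Oriented Riemannian manifolds and the fields of the fluid -/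

/-- The differential `dT` of a function, as a `1`-form. -/
def differential (T : M → ℝ) (x : M) : TangentSpace I x [⋀^Fin 1]→ₗ[ℝ] ℝ :=
  oneForm (mvfderiv I T x).toLinearMap

/-- The covariant differential `∇u` as a vector-valued `1`-form, `X ↦ ∇_X u`. -/
def velocityGradient (u : Π x : M, TangentSpace I x) (x : M) :
    TangentSpace I x [⋀^Fin 1]→ₗ[ℝ] TangentSpace I x :=
  oneForm (leviCivita u x).toLinearMap

/-- The divergence `div u = ∇_b u^b`. -/
def divergence (u : Π x : M, TangentSpace I x) (x : M) : ℝ :=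
  LinearMap.trace ℝ (TangentSpace I x) (leviCivita u x).toLinearMap

/-- The rate of strain `ε = ½ L_u g`, a `(0, 2)`-tensor field. -/
def rateOfStrain (u : Π x : M, TangentSpace I x) (x : M) :
    TangentSpace I x →ₗ[ℝ] TangentSpace I x →ₗ[ℝ] ℝ :=
  (1 / 2 : ℝ) • (ContinuousLinearMap.coeLM ℝ ∘ₗ (lieDerivMetric u x).toLinearMap)

variable (I M) in
/-- An orientation of the manifold: an orientation of every tangent space, locally constant in
the local trivializations of the tangent bundle. -/
structure ManifoldOrientation (n : ℕ) where
  /-- The orientation of the tangent space at a point. -/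
  at_ (x : M) : Orientation ℝ (TangentSpace I x) (Fin n)
  locally_constant (x₀ : M) : ∀ᶠ x in 𝓝 x₀,
    ∀ hx : x ∈ (trivializationAt E (fun x : M ↦ TangentSpace I x) x₀).baseSet,
      Orientation.map (Fin n)
          ((trivializationAt E (fun x : M ↦ TangentSpace I x) x₀).linearEquivAt ℝ x hx) (at_ x)
        = Orientation.map (Fin n)
          ((trivializationAt E (fun x : M ↦ TangentSpace I x) x₀).linearEquivAt ℝ x₀
            (FiberBundle.mem_baseSet_trivializationAt' x₀)) (at_ x₀)

variable {m : ℕ} [Fact (finrank ℝ E = m + 1)] (o : ManifoldOrientation I M (m + 1))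

/-- The Riemannian volume form `𝒱`. -/
def volForm (x : M) : TangentSpace I x [⋀^Fin (m + 1)]→ₗ[ℝ] ℝ := (o.at_ x).volumeForm

/-- Fourier's law `Q = -k ⋆ dT`. -/
def fourierHeatFlux (k T : M → ℝ) (x : M) : TangentSpace I x [⋀^Fin m]→ₗ[ℝ] ℝ :=
  -(k x • hodgeStar (Nat.add_comm 1 m) (o.at_ x) (differential T x))

/-- The bulk stress `𝒯_λ = λ div(u) 𝒱`, a covector-valued `m`-form. -/
def bulkStress (lam : M → ℝ) (u : Π x : M, TangentSpace I x) (x : M) :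
    TangentSpace I x [⋀^Fin m]→ₗ[ℝ] Dual ℝ (TangentSpace I x) :=
  topAsCovectorValued ((lam x * divergence u x) • volForm o x)

/-- The shear stress `𝒯_κ = 2 κ ⋆₂ ε`: the first slot of `ε` is its covector value, the second
its form leg. -/
def shearStress (kap : M → ℝ) (u : Π x : M, TangentSpace I x) (x : M) :
    TangentSpace I x [⋀^Fin m]→ₗ[ℝ] Dual ℝ (TangentSpace I x) :=
  (2 * kap x) • hodgeStar (N := Dual ℝ (TangentSpace I x)) (Nat.add_comm 1 m) (o.at_ x)
    (oneForm (rateOfStrain u x).flip)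

/-- The Newtonian viscous stress `𝒯_r = 𝒯_λ + 𝒯_κ`. -/
def viscousStress (lam kap : M → ℝ) (u : Π x : M, TangentSpace I x) (x : M) :
    TangentSpace I x [⋀^Fin m]→ₗ[ℝ] Dual ℝ (TangentSpace I x) :=
  bulkStress o lam u x + shearStress o kap u x

/-- The entropy source `𝔡_T = -(1 / T²) dT ∧ Q` due to temperature gradients. -/
def thermalEntropySource (T : M → ℝ) (Q : Π x : M, TangentSpace I x [⋀^Fin m]→ₗ[ℝ] ℝ) (x : M) :
    TangentSpace I x [⋀^Fin (m + 1)]→ₗ[ℝ] ℝ :=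
  -((1 / T x ^ 2) • wedge (Nat.add_comm 1 m) (differential T x) (Q x))

/-- The entropy source `𝔡_𝒯 = (1 / T) ∇u ∧̇ 𝒯` due to a stress `𝒯`. -/
def stressEntropySource (T : M → ℝ) (u : Π x : M, TangentSpace I x)
    (τ : Π x : M, TangentSpace I x [⋀^Fin m]→ₗ[ℝ] Dual ℝ (TangentSpace I x)) (x : M) :
    TangentSpace I x [⋀^Fin (m + 1)]→ₗ[ℝ] ℝ :=
  (1 / T x) • dotWedge (Nat.add_comm 1 m) (velocityGradient u x) (τ x)

end Manifold
end FourierNavierStokes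
end

/-! Apart from one identity for `L_u g`, everything is linear algebra in a single tangent space. The
Hodge star of a 1-form and a top form regarded as covector-valued are both sums of terms `ι_w η ⊗ c`
with `η` a top form. Since `α ∧ ι_w η = α(w) η` (`wedgeWith_insertFirst`), wedging with a 1-form
becomes a finite contraction. The bulk stress thus yields the trace of `∇u`
(`dotWedge_topAsCovectorValued`), and the shear stress yields `∑ ε(∇_{eᵢ}u, eᵢ)` over an orthonormal
basis (`wedgeWith_hodgeStar`).

The geometric input is `lieDerivMetric_apply`: by the Koszul formula, `ε` is the symmetric part of
`∇u`. Contracting `∇u` with the symmetric tensor `ε` sees only that part, which gives `ε : ε`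
(`sum_apply_eq_doubleContraction`).

Nonnegativity follows because the coefficients of `𝒱` are nonnegative combinations of squares and
`𝒱` is positive on positively oriented bases (`volumeForm_pos`). -/

namespace FourierNavierStokes

/-! ### Wedge products and interior products of top forms -/

section Pointwise

variable {V : Type*} [AddCommGroup V] [Module ℝ V]
  {N N₁ N₂ N₃ : Type*} [AddCommGroup N] [Module ℝ N] [AddCommGroup N₁] [Module ℝ N₁]
  [AddCommGroup N₂] [Module ℝ N₂] [AddCommGroup N₃] [Module ℝ N₃]

theorem alternatingMap_sum_apply {ι ι' : Type*} (s : Finset ι) (f : ι → V [⋀^ι']→ₗ[ℝ] N)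
    (v : ι' → V) : (∑ i ∈ s, f i) v = ∑ i ∈ s, f i v :=
  map_sum (AddMonoidHom.mk' (fun g : V [⋀^ι']→ₗ[ℝ] N ↦ g v) fun _ _ ↦ rfl) f s

theorem wedgeWith_add_right {p q n : ℕ} (h : p + q = n) (B : N₁ →ₗ[ℝ] N₂ →ₗ[ℝ] N₃)
    (α : V [⋀^Fin p]→ₗ[ℝ] N₁) (β γ : V [⋀^Fin q]→ₗ[ℝ] N₂) :
    wedgeWith h B α (β + γ) = wedgeWith h B α β + wedgeWith h B α γ := by
  have h' : α.domCoprod (β + γ) = α.domCoprod β + α.domCoprod γ := by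
    simp only [← AlternatingMap.domCoprod'_apply, TensorProduct.tmul_add, map_add]
  ext v
  simp [wedgeWith, h', -AlternatingMap.domCoprod_apply]

theorem wedgeWith_smul_right {p q n : ℕ} (h : p + q = n) (B : N₁ →ₗ[ℝ] N₂ →ₗ[ℝ] N₃)
    (α : V [⋀^Fin p]→ₗ[ℝ] N₁) (c : ℝ) (β : V [⋀^Fin q]→ₗ[ℝ] N₂) :
    wedgeWith h B α (c • β) = c • wedgeWith h B α β := by
  have h' : α.domCoprod (c • β) = c • α.domCoprod β := by
    simp only [← AlternatingMap.domCoprod'_apply, TensorProduct.tmul_smul, map_smul]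
  ext v
  simp [wedgeWith, h', -AlternatingMap.domCoprod_apply]

theorem wedgeWith_sum_right {ι : Type*} (s : Finset ι) {p q n : ℕ} (h : p + q = n)
    (B : N₁ →ₗ[ℝ] N₂ →ₗ[ℝ] N₃) (α : V [⋀^Fin p]→ₗ[ℝ] N₁) (β : ι → V [⋀^Fin q]→ₗ[ℝ] N₂) :
    wedgeWith h B α (∑ i ∈ s, β i) = ∑ i ∈ s, wedgeWith h B α (β i) :=
  map_sum (AddMonoidHom.mk' (wedgeWith h B α) (wedgeWith_add_right h B α)) β s

/-- The sign in the entropy source cancels the sign in Fourier's law. -/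
theorem neg_smul_wedge_neg_smul {p q n : ℕ} (h : p + q = n) (α : V [⋀^Fin p]→ₗ[ℝ] ℝ)
    (β : V [⋀^Fin q]→ₗ[ℝ] ℝ) (c d : ℝ) :
    -(c • wedge h α (-(d • β))) = (d * c) • wedge h α β := by
  have hβ : -(d • β) = (-d) • β := by ext v; simp
  rw [hβ, wedge, wedgeWith_smul_right]
  ext v
  simp [wedge]
  ring

/-- For `p = 1`, only the identity shuffle contributes when the second factor vanishes on tuples
containing the first vector. -/
theorem domCoprod_apply_of_eq_zero {m : ℕ} (α : V [⋀^Fin 1]→ₗ[ℝ] N₁) (β : V [⋀^Fin m]→ₗ[ℝ] N₂)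
    (v : Fin 1 ⊕ Fin m → V) (hβ : ∀ u j, u j = v (Sum.inl 0) → β u = 0) :
    α.domCoprod β v = α (v ∘ Sum.inl) ⊗ₜ β (v ∘ Sum.inr) := by
  classical
  rw [AlternatingMap.domCoprod_apply, sum_apply]
  refine (Finset.sum_eq_single (Quotient.mk'' 1 : Equiv.Perm.ModSumCongr (Fin 1) (Fin m))
    ?_ ?_).trans ?_
  · intro σ _ hσ
    induction σ using Quotient.inductionOn' with | _ σ
    rw [AlternatingMap.domCoprod.summand_mk'']
    have key : β (fun j ↦ v (σ (Sum.inr j))) = 0 := by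
      -- If `σ` fixes the one-element block, its class is trivial, contrary to `hσ`; otherwise `v
      -- (Sum.inl 0)` is an argument of `β`.
      rcases hs : σ⁻¹ (Sum.inl 0) with i | j
      · refine absurd ?_ hσ
        refine Quotient.sound' (QuotientGroup.leftRel_apply.mpr ?_)
        rw [mul_one, inv_mem_iff]
        refine Equiv.Perm.mem_sumCongrHom_range_of_perm_mapsTo_inl ?_
        rintro _ ⟨k, rfl⟩
        rw [Equiv.Perm.inv_eq_iff_eq] at hs
        rw [Subsingleton.elim k i, ← hs]
        exact ⟨0, rfl⟩
      · rw [Equiv.Perm.inv_eq_iff_eq] at hs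
        exact hβ _ j (by rw [← hs])
    simp [key]
  · simp
  · rw [AlternatingMap.domCoprod.summand_mk'']
    simp [Function.comp_def]

theorem insertFirst_apply {p q n : ℕ} (h : p + q = n) (η : V [⋀^Fin n]→ₗ[ℝ] ℝ) (w : Fin p → V)
    (v : Fin q → V) :
    insertFirst h η w v = η (Sum.elim w v ∘ (finSumFinEquiv.trans (finCongr h)).symm) :=
  rfl

/-- The same vector fills two slots of `η`. This supplies the vanishing hypothesis of
`domCoprod_apply_of_eq_zero`. -/
theorem insertFirst_eq_zero_of_eq {p q n : ℕ} (h : p + q = n) (η : V [⋀^Fin n]→ₗ[ℝ] ℝ)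
    {w : Fin p → V} {v : Fin q → V} {i : Fin p} {j : Fin q} (hij : w i = v j) :
    insertFirst h η w v = 0 :=
  (η.domDomCongr (finSumFinEquiv.trans (finCongr h)).symm).map_eq_zero_of_eq (Sum.elim w v)
    (i := Sum.inl i) (j := Sum.inr j) hij (by simp)

/-- For a top-form `η`, `α ∧ ι_w η = α(w) η`. -/
theorem wedgeWith_insertFirst {ι : Type*} [Fintype ι] {m n : ℕ} (h : 1 + m = n)
    (b : Basis ι ℝ V) (hn : Fintype.card ι = n) (B : N₁ →ₗ[ℝ] N₂ →ₗ[ℝ] ℝ) (f : V →ₗ[ℝ] N₁)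
    (η : V [⋀^Fin n]→ₗ[ℝ] ℝ) (i : ι) (c : N₂) :
    wedgeWith h B (oneForm f) (formSMul (insertFirst h η fun _ ↦ b i) c) = B (f (b i)) c • η := by
  classical
  set e := finSumFinEquiv.trans (finCongr h) with he
  let g₀ : ι ≃ Fin n := Fintype.equivFinOfCardEq hn
  -- The swap moves `b i` to the slot of the 1-form, so that only the identity shuffle survives on
  -- the reindexed basis.
  let g := g₀.trans (Equiv.swap (g₀ i) (e (Sum.inl 0)))
  have hg : b.reindex g (e (Sum.inl 0)) = b i := by simp [g]
  generalize b.reindex g = b' at hg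
  -- Both sides are top forms, so comparing their values on `b'` suffices.
  rw [← hg, AlternatingMap.eq_smul_basis_det b' (wedgeWith _ _ _ _),
    AlternatingMap.eq_smul_basis_det b' (_ • η)]
  congr 1
  have h1 : (oneForm f).domCoprod (formSMul (insertFirst h η fun _ ↦ b' (e (Sum.inl 0))) c) (b' ∘ e)
      = _ := domCoprod_apply_of_eq_zero _ _ _ fun u j hu ↦ by
    have h0 : insertFirst h η (fun _ ↦ b' (e (Sum.inl 0))) u = 0 :=
      insertFirst_eq_zero_of_eq (i := 0) (j := j) h η hu.symm
    simp [formSMul, h0]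
  have h2 : Sum.elim (fun _ : Fin 1 ↦ b' (e (Sum.inl 0))) ((b' ∘ e) ∘ Sum.inr) = b' ∘ e := by
    ext (k | k)
    · simp [Subsingleton.elim k 0]
    · rfl
  have h3 : insertFirst h η (fun _ ↦ b' (e (Sum.inl 0))) ((b' ∘ e) ∘ Sum.inr) = η b' := by
    rw [insertFirst_apply, h2]
    congr 1
    ext k
    simp [he]
  refine (congrArg (TensorProduct.lift B) h1).trans ?_
  simp [formSMul, h3, oneForm, mul_comm]

/-- Expanding the covector slot in any basis gives `η = ∑ ι_{bᵢ} η ⊗ bⁱ`, and the contraction is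
then `∑ bⁱ(A bᵢ) = tr A`; no metric is involved. -/
theorem dotWedge_topAsCovectorValued {m : ℕ} [FiniteDimensional ℝ V] (hV : finrank ℝ V = m + 1)
    (A : V →ₗ[ℝ] V) (η : V [⋀^Fin (m + 1)]→ₗ[ℝ] ℝ) :
    dotWedge (Nat.add_comm 1 m) (oneForm A) (topAsCovectorValued η)
      = LinearMap.trace ℝ V A • η := by
  let b := finBasisOfFinrankEq ℝ V hV
  have h : topAsCovectorValued η = ∑ i, formSMul
      (insertFirst (Nat.add_comm 1 m) η fun _ ↦ b i) (b.coord i) := by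
    ext v w
    have hi (z : V) : insertFirst (Nat.add_comm 1 m) η (fun _ ↦ z) v = η.curryLeft z v := by
      rw [insertFirst_apply, AlternatingMap.curryLeft_apply_apply]
      congr 1
      ext k
      refine Fin.cases ?_ (fun k ↦ ?_) k
      · have : (finSumFinEquiv.trans (finCongr (Nat.add_comm 1 m))).symm 0 = Sum.inl 0 := by
          rw [Equiv.symm_apply_eq]; rfl
        simp only [Function.comp_apply, this, Sum.elim_inl, Matrix.cons_val_zero]
      · have : (finSumFinEquiv.trans (finCongr (Nat.add_comm 1 m))).symm k.succ = Sum.inr k := by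
          rw [Equiv.symm_apply_eq]; ext; simp
        simp only [Function.comp_apply, this, Sum.elim_inr, Matrix.cons_val_succ]
    have hs : topAsCovectorValued η v w = η.curryLeft w v := rfl
    rw [hs, alternatingMap_sum_apply, LinearMap.sum_apply]
    conv_lhs => rw [← b.sum_repr w, map_sum, alternatingMap_sum_apply]
    refine Finset.sum_congr rfl fun i _ ↦ ?_
    simp [formSMul, hi, mul_comm, -AlternatingMap.curryLeft_apply_apply]
  rw [h, dotWedge, wedgeWith_sum_right]
  simp only [wedgeWith_insertFirst _ b (Fintype.card_fin _), ← Finset.sum_smul]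
  congr 1
  rw [LinearMap.trace_eq_matrix_trace ℝ b]
  simp [Matrix.trace, LinearMap.toMatrix_apply]

end Pointwise

/-! ### Volume form, Hodge star and symmetric contraction -/

section Metric

section

variable {V : Type*} [NormedAddCommGroup V] [InnerProductSpace ℝ V]

/-- The volume form is the determinant with respect to an orthonormal basis of orientation `o`,
hence positive on bases of that orientation. -/
theorem volumeForm_pos {m : ℕ} [Fact (finrank ℝ V = m + 1)] (o : Orientation ℝ V (Fin (m + 1)))
    (b : Basis (Fin (m + 1)) ℝ V) (hb : b.orientation = o) : 0 < o.volumeForm b := by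
  have ho := o.finOrthonormalBasis_orientation m.succ_pos Fact.out
  rw [o.volumeForm_robust _ ho, ← Basis.orientation_eq_iff_det_pos, ho, hb]

theorem topFormNonneg_smul_volumeForm {m : ℕ} [Fact (finrank ℝ V = m + 1)]
    (o : Orientation ℝ V (Fin (m + 1))) {c : ℝ} (hc : 0 ≤ c) :
    TopFormNonneg o (c • o.volumeForm) :=
  fun b hb ↦ mul_nonneg hc (volumeForm_pos o b hb).le

end

variable {V : Type*} [NormedAddCommGroup V] [InnerProductSpace ℝ V] [FiniteDimensional ℝ V]
  {N₁ N₂ : Type*} [AddCommGroup N₁] [Module ℝ N₁] [AddCommGroup N₂] [Module ℝ N₂]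

/-- The defining property of the Hodge star on `1`-forms: `α ∧ ⋆β = ⟨α, β⟩ 𝒱`. -/
theorem wedgeWith_hodgeStar {m n : ℕ} (h : 1 + m = n) [hn : Fact (finrank ℝ V = n)]
    (o : Orientation ℝ V (Fin n)) (B : N₁ →ₗ[ℝ] N₂ →ₗ[ℝ] ℝ) (f : V →ₗ[ℝ] N₁) (g : V →ₗ[ℝ] N₂) :
    wedgeWith h B (oneForm f) (hodgeStar h o (oneForm g))
      = (∑ i, B (f (stdOrthonormalBasis ℝ V i)) (g (stdOrthonormalBasis ℝ V i)))
        • o.volumeForm := by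
  have key (i : Fin (finrank ℝ V)) (c : N₂) := wedgeWith_insertFirst h
    (stdOrthonormalBasis ℝ V).toBasis ((Fintype.card_fin _).trans hn.out) B f o.volumeForm i c
  simp only [OrthonormalBasis.coe_toBasis] at key
  -- For `p = 1` the multi-indices `Fin 1 → Fin (finrank ℝ V)` are single indices, and the factor `1
  -- / p!` is `1`.
  rw [hodgeStar, wedgeWith_smul_right, wedgeWith_sum_right, Finset.sum_smul,
    ← (Equiv.funUnique (Fin 1) (Fin (finrank ℝ V))).symm.sum_comp]
  have hg (i : Fin (finrank ℝ V)) : oneForm g (fun _ ↦ stdOrthonormalBasis ℝ V i)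
      = g (stdOrthonormalBasis ℝ V i) := rfl
  simp [hg, key]

theorem doubleContraction_self_nonneg (ζ : V →ₗ[ℝ] V →ₗ[ℝ] ℝ) : 0 ≤ doubleContraction ζ ζ :=
  Finset.sum_nonneg fun _ _ ↦ Finset.sum_nonneg fun _ _ ↦ mul_self_nonneg _

/-- If `ζ` is the symmetric part of `(v, w) ↦ ⟨A v, w⟩`, then `∑ ζ(A eᵢ, eᵢ) = ζ : ζ`. -/
theorem sum_apply_eq_doubleContraction (ζ : V →ₗ[ℝ] V →ₗ[ℝ] ℝ) (A : V →ₗ[ℝ] V)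
    (hζ : ∀ v w, 2 * ζ v w = inner ℝ (A v) w + inner ℝ (A w) v) :
    ∑ i, ζ (A (stdOrthonormalBasis ℝ V i)) (stdOrthonormalBasis ℝ V i)
      = doubleContraction ζ ζ := by
  set e := stdOrthonormalBasis ℝ V
  have hsymm (v w : V) : ζ v w = ζ w v := by linarith [hζ v w, hζ w v]
  have h1 : ∑ i, ζ (A (e i)) (e i) = ∑ i, ∑ j, inner ℝ (A (e i)) (e j) * ζ (e i) (e j) := by
    refine Finset.sum_congr rfl fun i _ ↦ ?_
    conv_lhs => rw [hsymm, ← e.sum_repr' (A (e i))]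
    simp [real_inner_comm]
  have h2 : ∑ i, ζ (A (e i)) (e i) = ∑ i, ∑ j, inner ℝ (A (e j)) (e i) * ζ (e i) (e j) := by
    rw [h1, Finset.sum_comm]
    exact Finset.sum_congr rfl fun i _ ↦ Finset.sum_congr rfl fun j _ ↦ by rw [hsymm]
  -- Averaging `h1` with its transposed form `h2` symmetrizes `⟨A eᵢ, eⱼ⟩` into `ζ`: one copy of the
  -- sum is expanded by each.
  have h3 : 2 * doubleContraction ζ ζ = 2 * ∑ i, ζ (A (e i)) (e i) := by
    nth_rewrite 1 [two_mul (∑ i, _)]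
    nth_rewrite 1 [h1]
    rw [h2, ← Finset.sum_add_distrib, doubleContraction, Finset.mul_sum]
    refine Finset.sum_congr rfl fun i _ ↦ ?_
    rw [← Finset.sum_add_distrib, Finset.mul_sum]
    refine Finset.sum_congr rfl fun j _ ↦ ?_
    rw [← mul_assoc, hζ, add_mul]
  linarith

end Metric

/-! ### Rate of strain and entropy sources on the manifold -/

section Manifold

variable {E : Type*} [NormedAddCommGroup E] [NormedSpace ℝ E] [FiniteDimensional ℝ E]
  {H : Type*} [TopologicalSpace H] {I : ModelWithCorners ℝ E H}
  {M : Type*} [TopologicalSpace M] [ChartedSpace H M]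
  [RiemannianBundle (fun x : M ↦ TangentSpace I x)] [IsManifold I 2 M]
  {m : ℕ} [Fact (finrank ℝ E = m + 1)] (o : ManifoldOrientation I M (m + 1))

theorem thermalEntropySource_fourierHeatFlux (k T : M → ℝ) (x : M) :
    thermalEntropySource T (fourierHeatFlux o k T) x
      = (k x / T x ^ 2) • wedge (Nat.add_comm 1 m) (differential T x)
          (hodgeStar (Nat.add_comm 1 m) (o.at_ x) (differential T x)) := by
  rw [← mul_one_div]
  exact neg_smul_wedge_neg_smul _ _ _ _ _

variable [IsContMDiffRiemannianBundle I 1 E (fun x : M ↦ TangentSpace I x)]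
  {u : Π x : M, TangentSpace I x} {x : M}

/-- `(L_u g)(v, w) = g(∇_v u, w) + g(∇_w u, v)`. -/
theorem lieDerivMetric_apply (hu : MDiffAt (T% u) x) (v w : TangentSpace I x) :
    lieDerivMetric u x v w = inner ℝ (leviCivita u x v) w + inner ℝ (leviCivita u x w) v := by
  have hX := mdifferentiableAt_extend I E v
  have hZ := mdifferentiableAt_extend I E w
  have h0 : lieDerivMetric u x v w = lieDerivMetricAux u (extend E v) (extend E w) x :=
    TensorialAt.mkHom₂_apply_eq_extend ..
  have h1 := inner_leviCivita hu hX hZ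
  have h2 := inner_leviCivita hu hZ hX
  rw [extend_apply_self, extend_apply_self] at h1 h2
  rw [h0, h1, h2]
  -- Adding the two Koszul expressions cancels the terms antisymmetric in the two extensions: their
  -- mutual bracket and the derivatives along them.
  simp only [koszul, lieDerivMetricAux, mlieBracket_swap_apply (V := extend E w) (W := extend E v),
    mlieBracket_swap_apply (V := extend E v) (W := u),
    mlieBracket_swap_apply (V := extend E w) (W := u),
    dirDerivInner_comm _ u, dirDerivInner_comm u (extend E w) (extend E v), inner_neg_left,
    real_inner_comm _ (extend E v x)]
  ring

theorem stressEntropySource_viscousStress (hu : MDiffAt (T% u) x) (T lam kap : M → ℝ) :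
    stressEntropySource T u (viscousStress o lam kap u) x
      = ((1 / T x) * (lam x * divergence u x ^ 2
          + 2 * kap x * doubleContraction (rateOfStrain u x) (rateOfStrain u x)))
        • volForm o x := by
  -- The factor `2` absorbs the `½` in `ε = ½ L_u g`.
  have hε (v w : TangentSpace I x) : 2 * rateOfStrain u x v w
      = inner ℝ ((leviCivita u x).toLinearMap v) w + inner ℝ ((leviCivita u x).toLinearMap w) v := by
    refine Eq.trans ?_ (lieDerivMetric_apply hu v w)
    simp [rateOfStrain]
  have hbulk := dotWedge_topAsCovectorValued (V := TangentSpace I x) Fact.out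
    (leviCivita u x).toLinearMap ((lam x * divergence u x) • volForm o x)
  have hshear := wedgeWith_hodgeStar (V := TangentSpace I x) (Nat.add_comm 1 m) (o.at_ x)
    (Dual.eval ℝ (TangentSpace I x)) (leviCivita u x).toLinearMap (rateOfStrain u x).flip
  have hsum := sum_apply_eq_doubleContraction _ _ hε
  rw [dotWedge] at hbulk
  rw [stressEntropySource, viscousStress, bulkStress, shearStress, dotWedge, velocityGradient,
    wedgeWith_add_right, wedgeWith_smul_right, hbulk, hshear]
  simp only [Dual.eval_apply, LinearMap.flip_apply, hsum]
  rw [← divergence, volForm, smul_smul, smul_smul, ← add_smul, smul_smul]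
  congr 1
  ring

end Manifold

end FourierNavierStokes

/-! ### Entropy source formulas and their signs -/

theorem mainTheorem3 {m : ℕ}
    {E : Type*} [NormedAddCommGroup E] [NormedSpace ℝ E] [FiniteDimensional ℝ E]
    [Fact (Module.finrank ℝ E = m + 1)]
    {H : Type*} [TopologicalSpace H] {I : ModelWithCorners ℝ E H}
    {M : Type*} [TopologicalSpace M] [ChartedSpace H M] [IsManifold I ∞ M]
    [RiemannianBundle (fun x : M ↦ TangentSpace I x)]
    [IsContMDiffRiemannianBundle I ∞ E (fun x : M ↦ TangentSpace I x)]
    (o : FourierNavierStokes.ManifoldOrientation I M (m + 1))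
    (u : Π x : M, TangentSpace I x) (hu : ContMDiff I I.tangent 1 (T% u))
    (T : M → ℝ) (hT : ContMDiff I 𝓘(ℝ, ℝ) 1 T) (hT_pos : ∀ x, 0 < T x)
    (k lam kap : M → ℝ) :
    (∀ x, FourierNavierStokes.thermalEntropySource T
          (FourierNavierStokes.fourierHeatFlux o k T) x
        = (k x / T x ^ 2) • FourierNavierStokes.wedge (Nat.add_comm 1 m)
            (FourierNavierStokes.differential T x)
            (FourierNavierStokes.hodgeStar (Nat.add_comm 1 m) (o.at_ x)
              (FourierNavierStokes.differential T x))) ∧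
    ((∀ x, 0 ≤ k x) → ∀ x, FourierNavierStokes.TopFormNonneg (o.at_ x)
        (FourierNavierStokes.thermalEntropySource T
          (FourierNavierStokes.fourierHeatFlux o k T) x)) ∧
    (∀ x, FourierNavierStokes.stressEntropySource T u
          (FourierNavierStokes.viscousStress o lam kap u) x
        = ((1 / T x) * (lam x * FourierNavierStokes.divergence u x ^ 2
            + 2 * kap x * FourierNavierStokes.doubleContraction
                (FourierNavierStokes.rateOfStrain u x) (FourierNavierStokes.rateOfStrain u x)))
          • FourierNavierStokes.volForm o x) ∧
    ((∀ x, 0 ≤ lam x) → (∀ x, 0 ≤ kap x) → ∀ x, FourierNavierStokes.TopFormNonneg (o.at_ x)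
        (FourierNavierStokes.stressEntropySource T u
          (FourierNavierStokes.viscousStress o lam kap u) x)) := by
  have hstress (x : M) := FourierNavierStokes.stressEntropySource_viscousStress o
    ((hu x).mdifferentiableAt one_ne_zero) T lam kap
  have hthermal := FourierNavierStokes.thermalEntropySource_fourierHeatFlux o k T
  refine ⟨hthermal, fun hk x ↦ ?_, hstress, fun hlam hkap x ↦ ?_⟩
  · rw [hthermal x]
    -- With both factors equal to `dT`, the coefficient of `𝒱` is the sum of squares `∑ dT(eᵢ)²`.
    have h := FourierNavierStokes.wedgeWith_hodgeStar (V := TangentSpace I x) (Nat.add_comm 1 m)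
      (o.at_ x) (LinearMap.mul ℝ ℝ) (mvfderiv I T x).toLinearMap (mvfderiv I T x).toLinearMap
    rw [FourierNavierStokes.wedge, FourierNavierStokes.differential, h, smul_smul]
    exact FourierNavierStokes.topFormNonneg_smul_volumeForm (V := TangentSpace I x) (o.at_ x)
      (mul_nonneg (div_nonneg (hk x) (sq_nonneg _)) (Finset.sum_nonneg fun _ _ ↦ mul_self_nonneg _))
  · rw [hstress x]
    refine FourierNavierStokes.topFormNonneg_smul_volumeForm (V := TangentSpace I x) (o.at_ x) ?_
    have := FourierNavierStokes.doubleContraction_self_nonneg (V := TangentSpace I x)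
      (FourierNavierStokes.rateOfStrain u x)
    have := hlam x
    have := hkap x
    have := hT_pos x
    positivity
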